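/- **Theorem 3.5.** Let $d\in\mathbb N$ and let $X\subset\mathbb R^d$ be a countable, relatively separated set, i.e. $\sup_{x\in\mathbb R^d}|X\cap(x+[0,1]^d)|<\infty$. Let $\mathcal H$ be a complex Hilbert space, let $0<p\le 1$ and $0<\delta\le 1$, and let $\nu_\delta(x)=(1+|x|)^\delta$ for $x\in\mathbb R^d$, where $|\cdot|$ is the Euclidean norm. For a weight $\nu:\mathbb R^d\to[0,\infty)$ let $\mathcal S^p_\nu=\mathcal S^p_\nu(X)$ be the set of all matrices $A=[A_{k,l}]_{k,l\in X}$ with entries in $B(\mathcal H)$ such that $$\|A\|_{\mathcal S^p_\nu}=\max\Big\{\sup_{k\in X}\sum_{l\in X}\|A_{k,l}\|^p\nu(k-l)^p,\ \sup_{l\in X}\sum_{k\in X}\|A_{k,l}\|^p\nu(k-l)^p\Big\}<\infty ,$$ with matrix multiplication and the involution $A^*=[(A_{l,k})^*]_{k,l\in X}$, and let $\mathcal S^p=\mathcal S^p_1$ be the unweighted case $\nu\equiv1$. For $A\in\mathcal S^p_\nu$ let $$r_{\mathcal S^p_\nu}(A)=\sup\{|\lambda|^p:\lambda\in\mathbb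 C,\ \lambda I-A\text{ has no two-sided inverse in }\mathcal S^p_\nu\},$$ and let $r_{B(\ell^2(X,\mathcal H))}(T)=\sup\{|\lambda|:\lambda\in\sigma(T)\}$ be the usual spectral radius of a bounded operator $T$ on $\ell^2(X,\mathcal H)$ (suprema are taken in $[0,\infty]$, with $\sup\emptyset=0$). Then every $A=A^*\in\mathcal S^p_{\nu_\delta}$ defines a bounded operator on $\ell^2(X,\mathcal H)$, again denoted by $A$, through $(Ax)_k=\sum_{l\in X}A_{k,l}x_l$ (convergent series), and $$r_{\mathcal S^p_{\nu_\delta}}(A)=r_{\mathcal S^p}(A)=r_{B(\ell^2(X,\mathcal H))}(A)^p .$$ -/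

import Mathlib

open scoped ENNReal

namespace SchurAlg

/-- A countable set `X ⊆ ℝ^d` is relatively separated if the numbers of points of `X` in the
translated unit cubes `x + [0,1]^d` are bounded uniformly in `x ∈ ℝ^d`. -/
def IsRelativelySeparated {d : ℕ} (X : Set (EuclideanSpace ℝ (Fin d))) : Prop :=
  X.Countable ∧ ∃ N : ℕ, ∀ x : EuclideanSpace ℝ (Fin d),
    (X ∩ {y | ∀ i, x i ≤ y i ∧ y i ≤ x i + 1}).encard ≤ N

/-- The polynomial weight `ν_δ(x) = (1 + |x|)^δ`, with `|x|` the Euclidean norm. -/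
noncomputable def polyWeight {d : ℕ} (δ : ℝ) (x : EuclideanSpace ℝ (Fin d)) : ℝ :=
  (1 + ‖x‖) ^ δ

section Matrices

variable {d : ℕ} {X : Set (EuclideanSpace ℝ (Fin d))}
  {H : Type*} [NormedAddCommGroup H] [InnerProductSpace ℂ H]

/-- The `p`-norm `‖A‖_{S^p_ν}`, `0 < p ≤ 1`, of a `B(H)`-valued matrix over `X`,
with value `∞` allowed:
the larger of `sup_k ∑_l ‖A_{k,l}‖^p ν(k-l)^p` and `sup_l ∑_k ‖A_{k,l}‖^p ν(k-l)^p`. -/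
noncomputable def schurNorm (p : ℝ) (ν : EuclideanSpace ℝ (Fin d) → ℝ)
    (A : Matrix X X (H →L[ℂ] H)) : ℝ≥0∞ :=
  max (⨆ k : X, ∑' l : X, ENNReal.ofReal (‖A k l‖ ^ p * ν (k - l) ^ p))
    (⨆ l : X, ∑' k : X, ENNReal.ofReal (‖A k l‖ ^ p * ν (k - l) ^ p))

/-- The Schur-type algebra `S^p_ν(X)`, `0 < p ≤ 1`, as a set of `B(H)`-valued matrices. -/
def schurClass (X : Set (EuclideanSpace ℝ (Fin d))) (H : Type*) [NormedAddCommGroup H]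
    [InnerProductSpace ℂ H] (p : ℝ) (ν : EuclideanSpace ℝ (Fin d) → ℝ) :
    Set (Matrix X X (H →L[ℂ] H)) :=
  {A | schurNorm p ν A < ∞}

/-- The product of two (possibly infinite) `B(H)`-valued matrices over `X`. If both factors lie in
`S^p_ν`, where `0 < p ≤ 1` and `ν ≥ 1`, then all these series converge absolutely in `B(H)`. -/
noncomputable def matMul (A B : Matrix X X (H →L[ℂ] H)) : Matrix X X (H →L[ℂ] H) :=
  Matrix.of fun k l => ∑' m : X, A k m * B m l

open Classical in
/-- The spectrum of `A` in `S^p_ν(X)`: the `z ∈ ℂ` such that `z I - A` has no two-sided inverse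
in `S^p_ν(X)` for the matrix product. -/
def schurSpectrum (p : ℝ) (ν : EuclideanSpace ℝ (Fin d) → ℝ)
    (A : Matrix X X (H →L[ℂ] H)) : Set ℂ :=
  {z | ¬ ∃ B ∈ schurClass X H p ν, matMul (z • 1 - A) B = 1 ∧ matMul B (z • 1 - A) = 1}

/-- The spectral radius in the `p`-Banach algebra `S^p_ν(X)`: the supremum of `|z|^p` over the
spectrum (in `[0,∞]`, so that nothing is presupposed about boundedness). -/
noncomputable def schurRadius (p : ℝ) (ν : EuclideanSpace ℝ (Fin d) → ℝ)
    (A : Matrix X X (H →L[ℂ] H)) : ℝ≥0∞ :=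
  ⨆ z ∈ schurSpectrum p ν A, ENNReal.ofReal (‖z‖ ^ p)

/-- The bounded operator `T` on `ℓ²(X, H)` is given by the matrix `A`:
`(T x)_k = ∑_l A_{k,l} x_l`, with convergent series. -/
def IsOperatorOf (T : lp (fun _ : X => H) 2 →L[ℂ] lp (fun _ : X => H) 2)
    (A : Matrix X X (H →L[ℂ] H)) : Prop :=
  ∀ (x : lp (fun _ : X => H) 2) (k : X), HasSum (fun l : X => A k l (x l)) (T x k)

end Matrices

end SchurAlg

/-!
The polynomial weight is subadditive up to a constant, so the weighted norm `‖·‖_w` and the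
unweighted norm `‖·‖_1` satisfy Brandenburg's inequality `‖T^(2n)‖_w ≲ ‖T^n‖_w ‖T^n‖_1`. The
unweighted norm is controlled by splitting a matrix into a band around the diagonal, which
contributes at most the operator norm times the polynomially bounded number of positions in a row
or column of the band, and a far part, which the weight pays for. By Gelfand's formula
`‖(T / z)^n‖` decays geometrically when `|z|` exceeds the spectral radius of `T` on `ℓ²`. If the
band width grows geometrically at a small enough rate, the two estimates make the weighted norms of
the powers of `T / z` summable, so that the Neumann series inverts `z - T` in the weighted class.
Conversely, by Schur's test every matrix of the unweighted class is a bounded operator on `ℓ²`, so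
an inverse of `z - T` in `S^p` is also an inverse of `z - T` on `ℓ²`.
-/

namespace SchurAlg

section GeometricRate

/-- The sequence `a` grows at most like `r ^ n`, up to a finite factor. -/
def HasGeometricRate (a : ℕ → ℝ≥0∞) (r : ℝ≥0∞) : Prop :=
  ∃ K ≠ ∞, ∀ n, a n ≤ K * r ^ n

variable {a b : ℕ → ℝ≥0∞} {c C D r s : ℝ≥0∞}

lemma HasGeometricRate.tsum_ne_top (h : HasGeometricRate a r) (hr : r < 1) : ∑' n, a n ≠ ∞ := by
  obtain ⟨K, hK, ha⟩ := h
  refine ne_top_of_le_ne_top ?_ (ENNReal.tsum_le_tsum ha)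
  rw [ENNReal.tsum_mul_left, ENNReal.tsum_geometric]
  exact ENNReal.mul_ne_top hK (ENNReal.inv_ne_top.2 (tsub_pos_of_lt hr).ne')

lemma hasGeometricRate_of_eventually_le (ha : ∀ n, a n ≠ ∞) (hr0 : r ≠ 0) (hr : r ≠ ∞)
    (h : ∀ᶠ n in Filter.atTop, a n ≤ r ^ n) : HasGeometricRate a r := by
  obtain ⟨N, hN⟩ := Filter.eventually_atTop.1 h
  refine ⟨1 + ∑ i ∈ Finset.range N, a i * (r ^ i)⁻¹, ENNReal.add_ne_top.2 ⟨ENNReal.one_ne_top,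
    ENNReal.sum_ne_top.2 fun i _ => ENNReal.mul_ne_top (ha i)
      (ENNReal.inv_ne_top.2 (pow_ne_zero i hr0))⟩, fun n => ?_⟩
  rcases le_or_gt N n with hn | hn
  · exact (hN n hn).trans (le_mul_of_one_le_left' le_self_add)
  · calc a n = a n * (r ^ n)⁻¹ * r ^ n := by
          rw [mul_assoc, ENNReal.inv_mul_cancel (pow_ne_zero n hr0) (ENNReal.pow_ne_top hr),
            mul_one]
      _ ≤ _ := by
          gcongr
          exact (Finset.single_le_sum (f := fun i => a i * (r ^ i)⁻¹) (fun _ _ => zero_le)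
            (Finset.mem_range.2 hn)).trans le_add_self

lemma hasGeometricRate_of_succ_le (ha : a 0 ≠ ∞) (h : ∀ n, a (n + 1) ≤ D * a n) :
    HasGeometricRate a D := by
  refine ⟨a 0, ha, fun n => ?_⟩
  induction n with
  | zero => simp
  | succ n ih =>
    calc a (n + 1) ≤ D * (a 0 * D ^ n) := (h n).trans (by gcongr)
      _ = a 0 * D ^ (n + 1) := by ring

lemma HasGeometricRate.mul_of_doubling (h : HasGeometricRate a r) (hr1 : 1 ≤ r) (hr : r ≠ ∞)
    (hs0 : s ≠ 0) (hs : s ≠ ∞) (hC : C ≠ ∞) (hD : D ≠ ∞) (hstep : ∀ n, a (n + 1) ≤ D * a n)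
    (hdouble : ∀ n, a (2 * n) ≤ C * s ^ (2 * n) * (a n * (1 + a n))) :
    HasGeometricRate a (r * s) := by
  obtain ⟨K, hK, ha⟩ := h
  set L := C * (K * (1 + K))
  have hL : L ≠ ∞ := by finiteness
  have heven : ∀ m, a (2 * m) ≤ L * (r * s) ^ (2 * m) := by
    intro m
    calc a (2 * m) ≤ C * s ^ (2 * m) * ((K * r ^ m) * (r ^ m + K * r ^ m)) := by
          refine (hdouble m).trans ?_
          gcongr
          exacts [ha m, one_le_pow₀ hr1, ha m]
      _ = L * (r * s) ^ (2 * m) := by ring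
  have hrs0 : r * s ≠ 0 := mul_ne_zero (one_pos.trans_le hr1).ne' hs0
  have hrs : r * s ≠ ∞ := ENNReal.mul_ne_top hr hs
  refine ⟨L + D * L * (r * s)⁻¹, ?_, fun n => ?_⟩
  · have := ENNReal.inv_ne_top.2 hrs0
    finiteness
  obtain ⟨m, rfl | rfl⟩ := n.even_or_odd'
  · exact (heven m).trans (by gcongr; exact le_self_add)
  · calc a (2 * m + 1) ≤ D * (L * (r * s) ^ (2 * m)) := (hstep _).trans (by gcongr; exact heven m)
      _ = D * L * (r * s)⁻¹ * (r * s) ^ (2 * m + 1) := by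
          rw [pow_succ', ← mul_assoc _ (r * s), mul_assoc (D * L),
            ENNReal.inv_mul_cancel hrs0 hrs]
          ring
      _ ≤ _ := by gcongr; exact le_add_self

/-- Each application of the doubling inequality improves the rate by the factor `s`, until the rate
drops below `1`. -/
lemma tsum_ne_top_of_doubling (ha : a 0 ≠ ∞) (hC : C ≠ ∞) (hD : D ≠ ∞) (hs0 : s ≠ 0) (hs : s < 1)
    (hstep : ∀ n, a (n + 1) ≤ D * a n)
    (hdouble : ∀ n, a (2 * n) ≤ C * s ^ (2 * n) * (a n * (1 + a n))) : ∑' n, a n ≠ ∞ := by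
  have hex : ∃ j, D * s ^ j < 1 := by
    have hlim : Filter.Tendsto (fun j => D * s ^ j) Filter.atTop (nhds (D * 0)) :=
      ENNReal.Tendsto.const_mul (ENNReal.tendsto_pow_atTop_nhds_zero_of_lt_one hs) (Or.inr hD)
    rw [mul_zero] at hlim
    exact (hlim.eventually_lt_const one_pos).exists
  have hrate : ∀ i ≤ Nat.find hex, HasGeometricRate a (D * s ^ i) := by
    intro i
    induction i with
    | zero => intro _; simpa using hasGeometricRate_of_succ_le ha hstep
    | succ i ih =>
      intro hi
      rw [pow_succ, ← mul_assoc]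
      exact (ih (Nat.le_of_succ_le hi)).mul_of_doubling (not_lt.1 (Nat.find_min hex hi))
        (by finiteness) hs0 hs.ne_top hC hD hstep hdouble
  exact (hrate _ le_rfl).tsum_ne_top (Nat.find_spec hex)

/-- **Brandenburg's trick**, in terms of the strong norms `a n` and the weak norms `b n` of the
`n`-th powers of an element. -/
lemma tsum_ne_top_of_brandenburg (hc : c ≠ ∞) (hC : C ≠ ∞) (hs0 : s ≠ 0) (hs : s < 1)
    (ha0 : a 0 ≠ ∞) (ha1 : a 1 ≠ ∞) (hba : ∀ n, b n ≤ a n)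
    (hmul : ∀ m n, a (m + n) ≤ c * (a m * b n + b m * a n))
    (hb : ∀ n, b n ≤ C * s ^ (2 * n) * (1 + a n)) : ∑' n, a n ≠ ∞ := by
  refine tsum_ne_top_of_doubling (C := 2 * c * C) (D := 2 * c * a 1) ha0 (by finiteness)
    (by finiteness) hs0 hs (fun n => ?_) fun n => ?_
  · calc a (n + 1) ≤ c * (a n * a 1 + a n * a 1) := (hmul n 1).trans (by gcongr <;> exact hba _)
      _ = 2 * c * a 1 * a n := by ring
  · calc a (2 * n) ≤ c * (a n * b n + b n * a n) := two_mul n ▸ hmul n n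
      _ = 2 * c * (a n * b n) := by ring
      _ ≤ 2 * c * (a n * (C * s ^ (2 * n) * (1 + a n))) := by gcongr; exact hb n
      _ = _ := by ring

lemma hasGeometricRate_enorm_pow {A : Type*} [NormedRing A] [NormedAlgebra ℂ A] [CompleteSpace A]
    {x : A} (hr : r ≠ ∞) (h : spectralRadius ℂ x < r) :
    HasGeometricRate (fun n => ‖x ^ n‖ₑ) r := by
  refine hasGeometricRate_of_eventually_le (fun _ => enorm_ne_top) (zero_le.trans_lt h).ne' hr ?_
  have hroot := spectrum.pow_nnnorm_pow_one_div_tendsto_nhds_spectralRadius x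
  filter_upwards [hroot.eventually_lt_const h, Filter.eventually_gt_atTop 0] with n hn hn0
  rw [one_div] at hn
  rw [← ENNReal.rpow_natCast]
  exact (ENNReal.rpow_inv_le_iff (by exact_mod_cast hn0)).1 hn.le

end GeometricRate

section Kernel

variable {α ι : Type*} {p : ℝ}

lemma tsum_rpow_le (x : α → ℝ≥0∞) (hp0 : 0 < p) (hp1 : p ≤ 1) :
    (∑' i, x i) ^ p ≤ ∑' i, x i ^ p := by
  have hfin (s : Finset α) : (∑ i ∈ s, x i) ^ p ≤ ∑ i ∈ s, x i ^ p :=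
    Finset.le_sum_of_subadditive (· ^ p) (ENNReal.zero_rpow_of_pos hp0).le
      (fun _ _ => ENNReal.rpow_add_le_add_rpow _ _ hp0.le hp1) s x
  exact le_of_tendsto' ((ENNReal.continuous_rpow_const (y := p)).continuousAt.tendsto.comp
    (ENNReal.summable (f := x)).hasSum) fun s => (hfin s).trans (ENNReal.sum_le_tsum s)

lemma tsum_le_tsum_rpow_rpow_inv (x : α → ℝ≥0∞) (hp0 : 0 < p) (hp1 : p ≤ 1) :
    ∑' i, x i ≤ (∑' i, x i ^ p) ^ p⁻¹ :=
  (ENNReal.le_rpow_inv_iff hp0).2 (tsum_rpow_le x hp0 hp1)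

lemma tsum_mul_rpow_le (a x : α → ℝ≥0∞) (hp : 1 ≤ p) :
    (∑' i, a i * x i) ^ p ≤ (∑' i, a i) ^ (p - 1) * ∑' i, a i * x i ^ p := by
  have hp0 : 0 < p := one_pos.trans_le hp
  have : 0 ≤ p - 1 := sub_nonneg.2 hp
  have hfin (s : Finset α) :
      (∑ i ∈ s, a i * x i) ^ p ≤ (∑ i ∈ s, a i) ^ (p - 1) * ∑ i ∈ s, a i * x i ^ p := by
    refine (ENNReal.rpow_le_rpow (ENNReal.inner_le_weight_mul_Lp_of_nonneg s hp a x)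
      hp0.le).trans_eq ?_
    rw [ENNReal.mul_rpow_of_nonneg _ _ hp0.le, ← ENNReal.rpow_mul, ENNReal.rpow_inv_rpow hp0.ne',
      sub_mul, one_mul, inv_mul_cancel₀ hp0.ne']
  refine le_of_tendsto' ((ENNReal.continuous_rpow_const (y := p)).continuousAt.tendsto.comp
    (ENNReal.summable (f := fun i => a i * x i)).hasSum) fun s => (hfin s).trans ?_
  gcongr <;> exact ENNReal.sum_le_tsum s

/-- The Schur norm of a nonnegative kernel: the larger of the suprema of its row sums and of its
column sums. -/
noncomputable def kernelNorm (f : ι → ι → ℝ≥0∞) : ℝ≥0∞ :=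
  max (⨆ k, ∑' l, f k l) (⨆ l, ∑' k, f k l)

lemma row_le_kernelNorm (f : ι → ι → ℝ≥0∞) (k : ι) : ∑' l, f k l ≤ kernelNorm f :=
  (le_iSup (fun k => ∑' l, f k l) k).trans (le_max_left _ _)

lemma col_le_kernelNorm (f : ι → ι → ℝ≥0∞) (l : ι) : ∑' k, f k l ≤ kernelNorm f :=
  (le_iSup (fun l => ∑' k, f k l) l).trans (le_max_right _ _)

lemma kernelNorm_le {f : ι → ι → ℝ≥0∞} {C : ℝ≥0∞} (hrow : ∀ k, ∑' l, f k l ≤ C)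
    (hcol : ∀ l, ∑' k, f k l ≤ C) : kernelNorm f ≤ C :=
  max_le (iSup_le hrow) (iSup_le hcol)

lemma kernelNorm_mono {f g : ι → ι → ℝ≥0∞} (h : ∀ k l, f k l ≤ g k l) :
    kernelNorm f ≤ kernelNorm g :=
  kernelNorm_le (fun k => (ENNReal.tsum_le_tsum (h k)).trans (row_le_kernelNorm g k))
    (fun l => (ENNReal.tsum_le_tsum fun k => h k l).trans (col_le_kernelNorm g l))

lemma kernelNorm_add_le (f g : ι → ι → ℝ≥0∞) :
    kernelNorm (fun k l => f k l + g k l) ≤ kernelNorm f + kernelNorm g := by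
  refine kernelNorm_le (fun k => ?_) (fun l => ?_) <;> rw [ENNReal.tsum_add]
  · exact add_le_add (row_le_kernelNorm f k) (row_le_kernelNorm g k)
  · exact add_le_add (col_le_kernelNorm f l) (col_le_kernelNorm g l)

lemma kernelNorm_const_mul_le (c : ℝ≥0∞) (f : ι → ι → ℝ≥0∞) :
    kernelNorm (fun k l => c * f k l) ≤ c * kernelNorm f := by
  refine kernelNorm_le (fun k => ?_) (fun l => ?_) <;> rw [ENNReal.tsum_mul_left]
  · gcongr; exact row_le_kernelNorm f k
  · gcongr; exact col_le_kernelNorm f l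

lemma kernelNorm_tsum_le (f : α → ι → ι → ℝ≥0∞) :
    kernelNorm (fun k l => ∑' n, f n k l) ≤ ∑' n, kernelNorm (f n) := by
  refine kernelNorm_le (fun k => ?_) (fun l => ?_) <;> rw [ENNReal.tsum_comm]
  · exact ENNReal.tsum_le_tsum fun n => row_le_kernelNorm (f n) k
  · exact ENNReal.tsum_le_tsum fun n => col_le_kernelNorm (f n) l

lemma kernelNorm_mul_le (f g : ι → ι → ℝ≥0∞) :
    kernelNorm (fun k l => ∑' m, f k m * g m l) ≤ kernelNorm f * kernelNorm g := by
  refine kernelNorm_le (fun k => ?_) (fun l => ?_) <;> rw [ENNReal.tsum_comm]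
  · calc ∑' m, ∑' l, f k m * g m l = ∑' m, f k m * ∑' l, g m l := by
          simp_rw [ENNReal.tsum_mul_left]
      _ ≤ (∑' m, f k m) * kernelNorm g := by
          rw [← ENNReal.tsum_mul_right]; gcongr; exact row_le_kernelNorm g _
      _ ≤ _ := by gcongr; exact row_le_kernelNorm f k
  · calc ∑' m, ∑' k, f k m * g m l = ∑' m, (∑' k, f k m) * g m l := by
          simp_rw [ENNReal.tsum_mul_right]
      _ ≤ kernelNorm f * ∑' m, g m l := by
          rw [← ENNReal.tsum_mul_left]; gcongr; exact col_le_kernelNorm f _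
      _ ≤ _ := by gcongr; exact col_le_kernelNorm g l

lemma kernelNorm_indicator_le (s : ι → ι → Prop) [∀ k l, Decidable (s k l)] {N : ℝ≥0∞}
    (hrow : ∀ k, ({l | s k l}.encard : ℝ≥0∞) ≤ N) (hcol : ∀ l, ({k | s k l}.encard : ℝ≥0∞) ≤ N) :
    kernelNorm (fun k l => if s k l then 1 else 0) ≤ N := by
  have hcount (u : ι → Prop) [DecidablePred u] :
      ∑' i, (if u i then 1 else 0 : ℝ≥0∞) = {i | u i}.encard := by
    rw [← ENNReal.tsum_set_one, tsum_subtype {i | u i} fun _ => (1 : ℝ≥0∞)]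
    exact tsum_congr fun i => by simp [Set.indicator_apply]
  exact kernelNorm_le (fun k => (hcount _).trans_le (hrow k))
    fun l => (hcount fun k => s k l).trans_le (hcol l)

lemma kernelNorm_le_kernelNorm_rpow_rpow_inv (f : ι → ι → ℝ≥0∞) (hp0 : 0 < p) (hp1 : p ≤ 1) :
    kernelNorm f ≤ kernelNorm (fun k l => f k l ^ p) ^ p⁻¹ := by
  refine kernelNorm_le (fun k => ?_) (fun l => ?_)
  · refine (tsum_le_tsum_rpow_rpow_inv _ hp0 hp1).trans ?_
    gcongr
    exact row_le_kernelNorm (fun k l => f k l ^ p) k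
  · refine (tsum_le_tsum_rpow_rpow_inv _ hp0 hp1).trans ?_
    gcongr
    exact col_le_kernelNorm (fun k l => f k l ^ p) l

/-- **Schur's test** for a nonnegative kernel. -/
lemma tsum_rpow_tsum_mul_le (f : ι → ι → ℝ≥0∞) (x : ι → ℝ≥0∞) (hp : 1 ≤ p) :
    ∑' k, (∑' l, f k l * x l) ^ p ≤ kernelNorm f ^ p * ∑' l, x l ^ p := by
  have hp1 : 0 ≤ p - 1 := sub_nonneg.2 hp
  calc ∑' k, (∑' l, f k l * x l) ^ p
      ≤ ∑' k, kernelNorm f ^ (p - 1) * ∑' l, f k l * x l ^ p := by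
        gcongr with k
        refine (tsum_mul_rpow_le (f k) x hp).trans ?_
        gcongr
        exact row_le_kernelNorm f k
    _ = kernelNorm f ^ (p - 1) * ∑' l, (∑' k, f k l) * x l ^ p := by
        rw [ENNReal.tsum_mul_left, ENNReal.tsum_comm]
        simp_rw [ENNReal.tsum_mul_right]
    _ ≤ kernelNorm f ^ (p - 1) * (kernelNorm f * ∑' l, x l ^ p) := by
        gcongr
        rw [← ENNReal.tsum_mul_left]
        gcongr with l
        exact col_le_kernelNorm f l
    _ = kernelNorm f ^ p * ∑' l, x l ^ p := by
        nth_rw 2 [← ENNReal.rpow_one (kernelNorm f)]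
        rw [← mul_assoc, ← ENNReal.rpow_add_of_nonneg _ _ hp1 zero_le_one, sub_add_cancel]

end Kernel

section WeightedNorm

variable {α ι F : Type*} [NormedAddCommGroup F] {p : ℝ} {v w : ι → ι → ℝ≥0∞}

/-- The `p`-norm of a matrix with respect to an arbitrary weight on its positions, so that
`‖A‖_{S^p_ν}` is `weightedNorm p w A` for `w k l = ν (k - l) ^ p`: the exponent `p` is part of the
weight. -/
noncomputable def weightedNorm (p : ℝ) (w : ι → ι → ℝ≥0∞) (A : Matrix ι ι F) : ℝ≥0∞ :=
  kernelNorm fun k l => ‖A k l‖ₑ ^ p * w k l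

lemma weightedNorm_mono (h : ∀ k l, v k l ≤ w k l) (A : Matrix ι ι F) :
    weightedNorm p v A ≤ weightedNorm p w A :=
  kernelNorm_mono fun k l => by gcongr; exact h k l

lemma weightedNorm_sub_le (hp0 : 0 ≤ p) (hp1 : p ≤ 1) (A B : Matrix ι ι F) :
    weightedNorm p w (A - B) ≤ weightedNorm p w A + weightedNorm p w B := by
  refine (kernelNorm_mono fun k l => ?_).trans (kernelNorm_add_le _ _)
  rw [← add_mul]
  gcongr
  exact (ENNReal.rpow_le_rpow enorm_sub_le hp0).trans (ENNReal.rpow_add_le_add_rpow _ _ hp0 hp1)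

lemma weightedNorm_smul_le {𝕜 : Type*} [NormedField 𝕜] [NormedSpace 𝕜 F] (hp0 : 0 ≤ p) (c : 𝕜)
    (A : Matrix ι ι F) : weightedNorm p w (c • A) ≤ ‖c‖ₑ ^ p * weightedNorm p w A := by
  refine (kernelNorm_mono fun k l => ?_).trans (kernelNorm_const_mul_le _ _)
  rw [Matrix.smul_apply, enorm_smul, ENNReal.mul_rpow_of_nonneg _ _ hp0, mul_assoc]

lemma weightedNorm_le_tsum (hp0 : 0 < p) (hp1 : p ≤ 1) {A : α → Matrix ι ι F} {B : Matrix ι ι F}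
    (h : ∀ k l, HasSum (fun n => A n k l) (B k l)) :
    weightedNorm p w B ≤ ∑' n, weightedNorm p w (A n) := by
  refine (kernelNorm_mono fun k l => ?_).trans (kernelNorm_tsum_le _)
  rw [ENNReal.tsum_mul_right]
  gcongr
  have hnorm : ‖B k l‖ₑ ≤ ∑' n, ‖A n k l‖ₑ :=
    (h k l).enorm_le_of_bounded ENNReal.summable.hasSum fun _ => le_rfl
  exact (ENNReal.rpow_le_rpow hnorm hp0.le).trans (tsum_rpow_le _ hp0 hp1)

lemma weightedNorm_mul_le (hp0 : 0 < p) (hp1 : p ≤ 1) {c : ℝ≥0∞}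
    (hw : ∀ k m l, w k l ≤ c * (w k m + w m l)) {A B C : Matrix ι ι F}
    (hC : ∀ k l, ‖C k l‖ₑ ≤ ∑' m, ‖A k m‖ₑ * ‖B m l‖ₑ) :
    weightedNorm p w C ≤
      c * (weightedNorm p w A * weightedNorm p 1 B + weightedNorm p 1 A * weightedNorm p w B) := by
  set a := fun k l => ‖A k l‖ₑ ^ p
  set b := fun k l => ‖B k l‖ₑ ^ p
  have hentry (k l : ι) : ‖C k l‖ₑ ^ p * w k l ≤
      c * (∑' m, (a k m * w k m) * (b m l * 1) + ∑' m, (a k m * 1) * (b m l * w m l)) := by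
    calc ‖C k l‖ₑ ^ p * w k l ≤ (∑' m, a k m * b m l) * w k l := by
          gcongr
          refine (ENNReal.rpow_le_rpow (hC k l) hp0.le).trans ((tsum_rpow_le _ hp0 hp1).trans_eq ?_)
          exact tsum_congr fun m => ENNReal.mul_rpow_of_nonneg _ _ hp0.le
      _ ≤ ∑' m, c * ((a k m * w k m) * (b m l * 1) + (a k m * 1) * (b m l * w m l)) := by
          rw [← ENNReal.tsum_mul_right]
          refine ENNReal.tsum_le_tsum fun m => ?_
          calc a k m * b m l * w k l ≤ a k m * b m l * (c * (w k m + w m l)) := by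
                gcongr; exact hw k m l
            _ = _ := by ring
      _ = _ := by rw [ENNReal.tsum_mul_left, ENNReal.tsum_add]
  refine (kernelNorm_mono hentry).trans ((kernelNorm_const_mul_le _ _).trans ?_)
  gcongr
  exact (kernelNorm_add_le _ _).trans
    (add_le_add (kernelNorm_mul_le _ _) (kernelNorm_mul_le _ _))

/-- The positions inside the band `s` are counted, those outside it are paid for by the weight. -/
lemma weightedNorm_one_le_of_band (hp0 : 0 ≤ p) {A : Matrix ι ι F} {M N c : ℝ≥0∞}
    (hM : ∀ k l, ‖A k l‖ₑ ≤ M) (s : ι → ι → Prop)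
    (hrow : ∀ k, ({l | s k l}.encard : ℝ≥0∞) ≤ N) (hcol : ∀ l, ({k | s k l}.encard : ℝ≥0∞) ≤ N)
    (hw : ∀ k l, ¬ s k l → 1 ≤ c * w k l) :
    weightedNorm p 1 A ≤ M ^ p * N + c * weightedNorm p w A := by
  classical
  have hentry (k l : ι) : ‖A k l‖ₑ ^ p * 1 ≤
      M ^ p * (if s k l then 1 else 0) + c * (‖A k l‖ₑ ^ p * w k l) := by
    by_cases hs : s k l
    · rw [if_pos hs]
      exact le_add_right (by gcongr; exact hM k l)
    · refine le_add_left ?_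
      calc ‖A k l‖ₑ ^ p * 1 ≤ ‖A k l‖ₑ ^ p * (c * w k l) := by gcongr; exact hw k l hs
        _ = c * (‖A k l‖ₑ ^ p * w k l) := by ring
  refine (kernelNorm_mono hentry).trans ((kernelNorm_add_le _ _).trans (add_le_add ?_ ?_))
  · refine (kernelNorm_const_mul_le _ _).trans ?_
    gcongr
    exact kernelNorm_indicator_le s hrow hcol
  · exact kernelNorm_const_mul_le _ _

lemma weightedNorm_one_matrix_le {R : Type*} [NormedRing R] [DecidableEq ι] (hp0 : 0 < p)
    (hR : ‖(1 : R)‖ₑ ≤ 1) (hw : ∀ k, w k k ≤ 1) :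
    weightedNorm p w (1 : Matrix ι ι R) ≤ 1 := by
  have hentry (k l : ι) :
      ‖(1 : Matrix ι ι R) k l‖ₑ ^ p * w k l ≤ if k = l then 1 else 0 := by
    by_cases hkl : k = l
    · subst hkl
      rw [Matrix.one_apply_eq, if_pos rfl]
      exact mul_le_one' (ENNReal.rpow_le_one hR hp0.le) (hw k)
    · simp [Matrix.one_apply_ne hkl, hkl, hp0]
  refine (kernelNorm_mono hentry).trans (kernelNorm_indicator_le _ ?_ ?_) <;> simp

end WeightedNorm

section Geometry

open scoped NNReal

/-- The polynomial weight `(1 + d(k, l)) ^ ε` on the positions of a matrix indexed by a metric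
space. -/
noncomputable def distWeight {ι : Type*} [PseudoEMetricSpace ι] (ε : ℝ) (k l : ι) : ℝ≥0∞ :=
  (1 + edist k l) ^ ε

/-- The balls of radius `r ≥ 1` have at most `C * r ^ d` points, uniformly in their centres. -/
def HasPolynomialGrowth (ι : Type*) [PseudoEMetricSpace ι] : Prop :=
  ∃ d : ℕ, ∃ C : ℝ≥0, ∀ (k : ι) (r : ℝ≥0), 1 ≤ r →
    ((Metric.closedEBall k r).encard : ℝ≥0∞) ≤ C * r ^ d

section PseudoEMetricSpace

variable {ι : Type*} [PseudoEMetricSpace ι] {p ε : ℝ}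

lemma one_le_distWeight (hε : 0 ≤ ε) (k l : ι) : 1 ≤ distWeight ε k l :=
  (ENNReal.one_rpow ε).ge.trans (ENNReal.rpow_le_rpow le_self_add hε)

lemma distWeight_self (ε : ℝ) (k : ι) : distWeight ε k k = 1 := by
  simp [distWeight]

lemma distWeight_le_mul_add (hε : 0 ≤ ε) (k m l : ι) :
    distWeight ε k l ≤ 2 ^ ε * (distWeight ε k m + distWeight ε m l) := by
  have hmax : 1 + edist k l ≤ 2 * max (1 + edist k m) (1 + edist m l) := by
    calc 1 + edist k l ≤ (1 + edist k m) + (1 + edist m l) := by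
          rw [add_assoc]
          gcongr
          exact (edist_triangle k m l).trans (by gcongr; exact le_add_self)
      _ ≤ 2 * max (1 + edist k m) (1 + edist m l) := by
          rw [two_mul]; gcongr; exacts [le_max_left _ _, le_max_right _ _]
  calc distWeight ε k l ≤ (2 * max (1 + edist k m) (1 + edist m l)) ^ ε :=
        ENNReal.rpow_le_rpow hmax hε
    _ = 2 ^ ε * max (distWeight ε k m) (distWeight ε m l) := by
        rw [ENNReal.mul_rpow_of_nonneg _ _ hε, (ENNReal.monotone_rpow_of_nonneg hε).map_max]; rfl
    _ ≤ _ := by gcongr; exact max_le le_self_add le_add_self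

lemma weightedNorm_one_le_distWeight (hε : 0 ≤ ε) {F : Type*} [NormedAddCommGroup F]
    (A : Matrix ι ι F) : weightedNorm p 1 A ≤ weightedNorm p (distWeight ε) A :=
  weightedNorm_mono (one_le_distWeight hε) A

/-- The entries at distance at most `v⁻¹` are counted, the others are paid for by the weight. -/
lemma HasPolynomialGrowth.exists_weightedNorm_one_le (hι : HasPolynomialGrowth ι) (hp : 0 ≤ p)
    (hε : 0 ≤ ε) (F : Type*) [NormedAddCommGroup F] :
    ∃ d : ℕ, ∃ C : ℝ≥0, ∀ (A : Matrix ι ι F) (M : ℝ≥0∞), (∀ k l, ‖A k l‖ₑ ≤ M) →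
      ∀ v : ℝ≥0∞, v ≠ 0 → v ≤ 1 → weightedNorm p 1 A ≤
        M ^ p * (C * (v ^ d)⁻¹) + v ^ ε * weightedNorm p (distWeight ε) A := by
  obtain ⟨d, C, hC⟩ := hι
  refine ⟨d, C, fun A M hM v hv0 hv1 => ?_⟩
  have hball (k : ι) : ((Metric.closedEBall k v⁻¹).encard : ℝ≥0∞) ≤ C * (v ^ d)⁻¹ := by
    have hradius : ((v⁻¹).toNNReal : ℝ≥0∞) = v⁻¹ := ENNReal.coe_toNNReal (ENNReal.inv_ne_top.2 hv0)
    have hcount := hC k (v⁻¹).toNNReal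
    rw [← ENNReal.coe_le_coe, hradius] at hcount
    simpa only [ENNReal.inv_pow] using hcount (ENNReal.one_le_inv.2 hv1)
  refine weightedNorm_one_le_of_band hp hM (fun k l => edist k l ≤ v⁻¹) (fun k => ?_) hball
    fun k l hkl => ?_
  · simp_rw [edist_comm k]
    exact hball k
  · calc 1 = (v * v⁻¹) ^ ε := by
          rw [ENNReal.mul_inv_cancel hv0 (ne_top_of_le_ne_top ENNReal.one_ne_top hv1),
            ENNReal.one_rpow]
      _ ≤ (v * (1 + edist k l)) ^ ε := by
          gcongr
          exact (not_le.1 hkl).le.trans le_add_self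
      _ = v ^ ε * distWeight ε k l := ENNReal.mul_rpow_of_nonneg _ _ hε

end PseudoEMetricSpace

variable {d : ℕ} {X : Set (EuclideanSpace ℝ (Fin d))}

lemma IsRelativelySeparated.exists_encard_closedBall_le (hX : IsRelativelySeparated X) :
    ∃ N : ℕ, ∀ (x : EuclideanSpace ℝ (Fin d)) (m : ℕ),
      (X ∩ Metric.closedBall x m).encard ≤ (N * (2 * m + 1) ^ d : ℕ) := by
  obtain ⟨-, N, hN⟩ := hX
  refine ⟨N, fun x m => ?_⟩
  let corners : Finset (Fin d → ℤ) := Fintype.piFinset fun _ => Finset.Icc (-(m : ℤ)) m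
  let corner (z : Fin d → ℤ) : EuclideanSpace ℝ (Fin d) := x + WithLp.toLp 2 fun i => (z i : ℝ)
  let cube (z : Fin d → ℤ) := X ∩ {y | ∀ i, corner z i ≤ y i ∧ y i ≤ corner z i + 1}
  have hcover : X ∩ Metric.closedBall x m ⊆ ⋃ z ∈ corners, cube z := by
    rintro y ⟨hyX, hy⟩
    refine Set.mem_biUnion (x := fun i => ⌊y i - x i⌋) ?_ ⟨hyX, fun i => ?_⟩
    · refine Fintype.mem_piFinset.2 fun i => Finset.mem_Icc.2 ?_
      have hi : |y i - x i| ≤ m :=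
        (PiLp.norm_apply_le (y - x) i).trans (by rwa [← dist_eq_norm])
      obtain ⟨hlow, hupp⟩ := abs_le.1 hi
      exact ⟨Int.le_floor.2 (by push_cast; exact hlow),
        Int.cast_le (R := ℝ).1 ((Int.floor_le _).trans (by exact_mod_cast hupp))⟩
    · have hlow := Int.floor_le (y i - x i)
      have hupp := Int.lt_floor_add_one (y i - x i)
      simp only [corner, PiLp.add_apply]
      constructor <;> linarith
  have hcard : corners.card = (2 * m + 1) ^ d := by
    rw [Fintype.card_piFinset_const, Int.card_Icc]
    congr 1
    omega
  calc (X ∩ Metric.closedBall x m).encard ≤ ∑ z ∈ corners, (cube z).encard :=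
        (Set.encard_le_encard hcover).trans (corners.set_encard_biUnion_le cube)
    _ ≤ ∑ _z ∈ corners, (N : ℕ∞) := Finset.sum_le_sum fun z _ => hN _
    _ = (N * (2 * m + 1) ^ d : ℕ) := by
        rw [Finset.sum_const, hcard, nsmul_eq_mul, mul_comm]
        norm_cast

lemma IsRelativelySeparated.hasPolynomialGrowth (hX : IsRelativelySeparated X) :
    HasPolynomialGrowth X := by
  obtain ⟨N, hN⟩ := hX.exists_encard_closedBall_le
  refine ⟨d, N * 5 ^ d, fun k r hr => ?_⟩
  have hball : (Metric.closedEBall k r).encard ≤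
      (X ∩ Metric.closedBall (k : EuclideanSpace ℝ (Fin d)) ⌈r⌉₊).encard := by
    rw [← Subtype.val_injective.encard_image]
    refine Set.encard_le_encard ?_
    rintro _ ⟨y, hy, rfl⟩
    refine ⟨y.2, ?_⟩
    have hy' : nndist y k ≤ r := by simpa [edist_nndist] using hy
    rw [Metric.mem_closedBall, ← Subtype.dist_eq, ← coe_nndist]
    exact_mod_cast hy'.trans (Nat.le_ceil r)
  have hceil : (2 * ⌈r⌉₊ + 1 : ℝ≥0) ≤ 5 * r := by
    calc (2 * ⌈r⌉₊ + 1 : ℝ≥0) ≤ 2 * (r + 1) + 1 := by gcongr; exact (Nat.ceil_lt_add_one r.2).le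
      _ = 2 * r + 3 * 1 := by ring
      _ ≤ 2 * r + 3 * r := by gcongr
      _ = 5 * r := by ring
  calc ((Metric.closedEBall k r).encard : ℝ≥0∞)
      ≤ ((N * (2 * ⌈r⌉₊ + 1) ^ d : ℕ) : ℕ∞) := by exact_mod_cast hball.trans (hN k _)
    _ = ((N * (2 * ⌈r⌉₊ + 1) ^ d : ℝ≥0) : ℝ≥0∞) := by push_cast; rfl
    _ ≤ ((N * (5 * r) ^ d : ℝ≥0) : ℝ≥0∞) := by gcongr
    _ = _ := by push_cast; ring

end Geometry

section LpEnorm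

variable {ι : Type*} {E : ι → Type*} [∀ i, NormedAddCommGroup (E i)] {q : ℝ≥0∞}

lemma tsum_enorm_rpow_eq [Fact (1 ≤ q)] (hq : q ≠ ∞) (x : lp E q) :
    ∑' i, ‖x i‖ₑ ^ q.toReal = ‖x‖ₑ ^ q.toReal := by
  have hq0 : 0 < q.toReal := ENNReal.toReal_pos (one_pos.trans_le Fact.out).ne' hq
  have hnorm := lp.hasSum_norm hq0 x
  rw [← ofReal_norm, ENNReal.ofReal_rpow_of_nonneg (norm_nonneg _) hq0.le, ← hnorm.tsum_eq,
    ENNReal.ofReal_tsum_of_nonneg (fun _ => by positivity) hnorm.summable]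
  exact tsum_congr fun i => by
    rw [← ofReal_norm, ENNReal.ofReal_rpow_of_nonneg (norm_nonneg _) hq0.le]

lemma memℓp_of_tsum_enorm_rpow_ne_top {x : ∀ i, E i} (hx : ∑' i, ‖x i‖ₑ ^ q.toReal ≠ ∞) :
    Memℓp x q :=
  memℓp_gen <| by simpa [← ENNReal.toReal_rpow] using ENNReal.summable_toReal hx

end LpEnorm

section Entries

/-- The bounded operators on `ℓ^q(ι, E)`. -/
abbrev LpEnd (𝕜 ι E : Type*) [NontriviallyNormedField 𝕜] [NormedAddCommGroup E] [NormedSpace 𝕜 E]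
    (q : ℝ≥0∞) [Fact (1 ≤ q)] : Type _ :=
  lp (fun _ : ι => E) q →L[𝕜] lp (fun _ : ι => E) q

variable {𝕜 ι E : Type*} [NontriviallyNormedField 𝕜] [NormedAddCommGroup E] [NormedSpace 𝕜 E]
  {q : ℝ≥0∞} [Fact (1 ≤ q)]

open Classical in
/-- The `(k, l)` matrix entry as a continuous linear function of the operator. -/
noncomputable def entryCLM (k l : ι) : LpEnd 𝕜 ι E q →L[𝕜] (E →L[𝕜] E) :=
  (ContinuousLinearMap.compL 𝕜 E (lp (fun _ : ι => E) q) E (lp.evalCLM 𝕜 (fun _ : ι => E) q k)) ∘L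
    ((ContinuousLinearMap.compL 𝕜 E (lp (fun _ : ι => E) q) (lp (fun _ : ι => E) q)).flip
      (lp.singleContinuousLinearMap 𝕜 (fun _ : ι => E) q l))

/-- The matrix of a bounded operator on `ℓ^q(ι, E)`. -/
noncomputable def entry (T : LpEnd 𝕜 ι E q) : Matrix ι ι (E →L[𝕜] E) :=
  Matrix.of fun k l => entryCLM k l T

variable (S T : LpEnd 𝕜 ι E q)

lemma entry_apply [DecidableEq ι] (k l : ι) (v : E) : entry T k l v = T (lp.single q l v) k := by
  obtain rfl : ‹DecidableEq ι› = fun a b => Classical.propDecidable (a = b) :=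
    Subsingleton.elim _ _
  rfl

lemma entry_one [DecidableEq ι] : entry (1 : LpEnd 𝕜 ι E q) = 1 := by
  ext k l v
  rw [entry_apply, one_apply_eq_self, lp.single_apply, Matrix.one_apply, Pi.single_apply]
  split_ifs <;> simp

lemma weightedNorm_entry_one_le {p : ℝ} {w : ι → ι → ℝ≥0∞} (hp : 0 < p) (hw : ∀ k, w k k ≤ 1) :
    weightedNorm p w (entry (1 : LpEnd 𝕜 ι E q)) ≤ 1 := by
  classical
  rw [entry_one]
  refine weightedNorm_one_matrix_le hp ?_ hw
  rw [← ofReal_norm]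
  exact ENNReal.ofReal_le_one.2 ContinuousLinearMap.norm_id_le

lemma entry_sub : entry (S - T) = entry S - entry T := by
  ext k l v; simp [entry]

lemma entry_smul (c : 𝕜) : entry (c • T) = c • entry T := by
  ext k l v; simp [entry]

lemma enorm_entry_le (k l : ι) : ‖entry T k l‖ₑ ≤ ‖T‖ₑ := by
  classical
  have hq0 : 0 < q := one_pos.trans_le Fact.out
  refine enorm_le_iff_norm_le.2 (ContinuousLinearMap.opNorm_le_bound _ (norm_nonneg T) fun v => ?_)
  rw [entry_apply, ← lp.norm_single (E := fun _ : ι => E) hq0 l v]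
  exact (lp.norm_apply_le_norm hq0.ne' _ k).trans (T.le_opNorm _)

lemma hasSum_entry (hq : q ≠ ∞) (x : lp (fun _ : ι => E) q) (k : ι) :
    HasSum (fun l => entry T k l (x l)) (T x k) := by
  classical
  exact (lp.hasSum_single hq x).mapL ((lp.evalCLM 𝕜 (fun _ : ι => E) q k) ∘L T)

lemma entry_injective (hq : q ≠ ∞) :
    Function.Injective (entry : LpEnd 𝕜 ι E q → Matrix ι ι (E →L[𝕜] E)) := by
  intro S T h
  ext x k
  exact (h ▸ hasSum_entry S hq x k).unique (hasSum_entry T hq x k)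

lemma hasSum_entry_mul_apply (hq : q ≠ ∞) (k l : ι) (v : E) :
    HasSum (fun m => entry S k m (entry T m l v)) (entry (S * T) k l v) := by
  classical
  exact hasSum_entry S hq (T (lp.single q l v)) k

lemma enorm_entry_mul_le (hq : q ≠ ∞) (k l : ι) :
    ‖entry (S * T) k l‖ₑ ≤ ∑' m, ‖entry S k m‖ₑ * ‖entry T m l‖ₑ := by
  refine ContinuousLinearMap.opENorm_le_bound _ fun v => ?_
  rw [← ENNReal.tsum_mul_right]
  refine (hasSum_entry_mul_apply S T hq k l v).enorm_le_of_bounded ENNReal.summable.hasSum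
    fun m => ?_
  rw [mul_assoc]
  exact (ContinuousLinearMap.le_opENorm _ _).trans
    (by gcongr; exact ContinuousLinearMap.le_opENorm _ _)

lemma tsum_enorm_tsum_apply_rpow_le (hq : q ≠ ∞) (A : Matrix ι ι (E →L[𝕜] E))
    (x : lp (fun _ : ι => E) q) :
    ∑' k, ‖∑' l, A k l (x l)‖ₑ ^ q.toReal ≤
      (kernelNorm (fun k l => ‖A k l‖ₑ) * ‖x‖ₑ) ^ q.toReal := by
  have hq1 : 1 ≤ q.toReal := by simpa using ENNReal.toReal_mono hq (Fact.out : 1 ≤ q)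
  have hq0 : 0 < q.toReal := one_pos.trans_le hq1
  calc ∑' k, ‖∑' l, A k l (x l)‖ₑ ^ q.toReal
      ≤ ∑' k, (∑' l, ‖A k l‖ₑ * ‖x l‖ₑ) ^ q.toReal := by
        gcongr with k
        exact enorm_tsum_le_tsum_enorm.trans
          (ENNReal.tsum_le_tsum fun l => ContinuousLinearMap.le_opENorm _ _)
    _ ≤ kernelNorm (fun k l => ‖A k l‖ₑ) ^ q.toReal * ∑' l, ‖x l‖ₑ ^ q.toReal :=
        tsum_rpow_tsum_mul_le (fun k l => ‖A k l‖ₑ) _ hq1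
    _ = _ := by rw [tsum_enorm_rpow_eq hq, ENNReal.mul_rpow_of_nonneg _ _ hq0.le]

variable [CompleteSpace E]

lemma hasSum_entry_mul (hq : q ≠ ∞) {k : ι} (hS : ∑' m, ‖entry S k m‖ₑ ≠ ∞) (l : ι) :
    HasSum (fun m => entry S k m * entry T m l) (entry (S * T) k l) := by
  have hsum : Summable fun m => entry S k m * entry T m l := by
    refine Summable.of_enorm (ne_top_of_le_ne_top
      (ENNReal.mul_ne_top hS (enorm_ne_top (x := T))) ?_)
    rw [← ENNReal.tsum_mul_right]
    gcongr with m
    refine (ContinuousLinearMap.opENorm_comp_le _ _).trans ?_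
    gcongr
    exact enorm_entry_le T m l
  convert hsum.hasSum using 1
  ext v
  exact (hasSum_entry_mul_apply S T hq k l v).unique
    (hsum.hasSum.mapL (ContinuousLinearMap.apply 𝕜 E v))

lemma summable_matrix_apply {A : Matrix ι ι (E →L[𝕜] E)} {k : ι} (hA : ∑' l, ‖A k l‖ₑ ≠ ∞)
    (x : lp (fun _ : ι => E) q) : Summable fun l => A k l (x l) := by
  have hq0 : q ≠ 0 := (one_pos.trans_le Fact.out).ne'
  refine Summable.of_enorm (ne_top_of_le_ne_top
    (ENNReal.mul_ne_top hA (enorm_ne_top (x := x))) ?_)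
  rw [← ENNReal.tsum_mul_right]
  gcongr with l
  refine (ContinuousLinearMap.le_opENorm _ _).trans ?_
  gcongr
  exact enorm_le_iff_norm_le.2 (lp.norm_apply_le_norm hq0 x l)

/-- **Schur's test** on `ℓ^q(ι, E)`. -/
lemma exists_entry_eq (hq : q ≠ ∞) {A : Matrix ι ι (E →L[𝕜] E)}
    (hA : kernelNorm (fun k l => ‖A k l‖ₑ) ≠ ∞) : ∃ T : LpEnd 𝕜 ι E q, entry T = A := by
  classical
  set M := kernelNorm (fun k l => ‖A k l‖ₑ)
  have hq0 : 0 < q.toReal := ENNReal.toReal_pos (one_pos.trans_le Fact.out).ne' hq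
  have hsum (x : lp (fun _ : ι => E) q) (k : ι) : Summable fun l => A k l (x l) :=
    summable_matrix_apply (ne_top_of_le_ne_top hA (row_le_kernelNorm (fun k l => ‖A k l‖ₑ) k)) x
  have hmem (x : lp (fun _ : ι => E) q) : Memℓp (fun k => ∑' l, A k l (x l)) q :=
    memℓp_of_tsum_enorm_rpow_ne_top (ne_top_of_le_ne_top (ENNReal.rpow_ne_top_of_nonneg hq0.le
      (ENNReal.mul_ne_top hA enorm_ne_top)) (tsum_enorm_tsum_apply_rpow_le hq A x))
  let L : lp (fun _ : ι => E) q →ₗ[𝕜] lp (fun _ : ι => E) q :=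
    { toFun := fun x => ⟨fun k => ∑' l, A k l (x l), hmem x⟩
      map_add' := fun x y => by
        ext k
        exact (tsum_congr fun l => map_add (A k l) _ _).trans ((hsum x k).tsum_add (hsum y k))
      map_smul' := fun c x => by
        ext k
        exact (tsum_congr fun l => map_smul (A k l) _ _).trans ((hsum x k).tsum_const_smul c) }
  have hL (x : lp (fun _ : ι => E) q) : ‖L x‖ ≤ M.toReal * ‖x‖ := by
    have hbound : ‖L x‖ₑ ≤ M * ‖x‖ₑ := by
      rw [← ENNReal.rpow_le_rpow_iff hq0, ← tsum_enorm_rpow_eq hq]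
      exact tsum_enorm_tsum_apply_rpow_le hq A x
    simpa using ENNReal.toReal_mono (ENNReal.mul_ne_top hA enorm_ne_top) hbound
  refine ⟨L.mkContinuous M.toReal hL, ?_⟩
  ext k l v
  rw [entry_apply]
  change ∑' m, A k m (lp.single (E := fun _ : ι => E) q l v m) = A k l v
  rw [tsum_eq_single l fun m hm => by rw [lp.single_apply_ne _ _ _ hm, map_zero],
    lp.single_apply_self]

end Entries

section Brandenburg

lemma exists_le_pow_of_lt_one {t : ℝ≥0∞} (ht : t < 1) {m : ℕ} (hm : m ≠ 0) :
    ∃ u ≠ 0, u < 1 ∧ t ≤ u ^ m := by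
  have hm0 : (0 : ℝ) < m := by positivity
  obtain ⟨u, htu, hu⟩ := exists_between (ENNReal.rpow_lt_one ht (inv_pos.2 hm0))
  refine ⟨u, (zero_le.trans_lt htu).ne', hu, ?_⟩
  rw [← ENNReal.rpow_natCast]
  exact (ENNReal.rpow_inv_le_iff hm0).1 htu.le

lemma pow_rpow_comm (x : ℝ≥0∞) (n : ℕ) (y : ℝ) : (x ^ n) ^ y = (x ^ y) ^ n := by
  rw [← ENNReal.rpow_natCast_mul, mul_comm, ENNReal.rpow_mul_natCast]

variable {𝕜 ι E F : Type*} [PseudoEMetricSpace ι] [NormedAddCommGroup F]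
  [NormedAddCommGroup E] {p ε : ℝ}

/-- With entries of size `O(r ^ n)` and a band of width `u ^ (-2 n)`, the band contributes
`O(r ^ (n p) * u ^ (-2 n d))`, which is `O(u ^ (2 n))` once `r ^ p ≤ u ^ (2 d + 2)`. -/
lemma HasPolynomialGrowth.exists_weightedNorm_one_le_pow_mul (hι : HasPolynomialGrowth ι)
    (hp : 0 < p) (hε : 0 < ε) {A : ℕ → Matrix ι ι F} {a : ℕ → ℝ≥0∞} {r : ℝ≥0∞}
    (hA : ∀ n k l, ‖A n k l‖ₑ ≤ a n) (ha : HasGeometricRate a r) (hr : r < 1) :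
    ∃ C ≠ ∞, ∃ s ≠ 0, s < 1 ∧ ∀ n,
      weightedNorm p 1 (A n) ≤ C * s ^ (2 * n) * (1 + weightedNorm p (distWeight ε) (A n)) := by
  obtain ⟨K, hK, ha⟩ := ha
  obtain ⟨d, C, hC⟩ := hι.exists_weightedNorm_one_le hp.le hε.le F
  obtain ⟨u, hu0, hu1, hru⟩ :=
    exists_le_pow_of_lt_one (ENNReal.rpow_lt_one hr hp) (m := 2 * d + 2) (by lia)
  set s := max u (u ^ ε)
  have hband (n : ℕ) : (K * r ^ n) ^ p * (C * ((u ^ (2 * n)) ^ d)⁻¹) ≤ K ^ p * C * s ^ (2 * n) := by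
    have hcancel : (u ^ (2 * n)) ^ d * ((u ^ (2 * n)) ^ d)⁻¹ = 1 :=
      ENNReal.mul_inv_cancel (by positivity) (by finiteness)
    calc (K * r ^ n) ^ p * (C * ((u ^ (2 * n)) ^ d)⁻¹)
        ≤ K ^ p * (u ^ (2 * d + 2)) ^ n * (C * ((u ^ (2 * n)) ^ d)⁻¹) := by
          rw [ENNReal.mul_rpow_of_nonneg _ _ hp.le, pow_rpow_comm]
          gcongr
      _ = K ^ p * C * u ^ (2 * n) * ((u ^ (2 * n)) ^ d * ((u ^ (2 * n)) ^ d)⁻¹) := by ring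
      _ ≤ K ^ p * C * s ^ (2 * n) := by
          rw [hcancel, mul_one]
          gcongr
          exact le_max_left _ _
  have hfar (n : ℕ) : (u ^ (2 * n)) ^ ε ≤ s ^ (2 * n) := by
    rw [pow_rpow_comm]
    gcongr
    exact le_max_right _ _
  refine ⟨K ^ p * C + 1, by finiteness, s, (lt_max_of_lt_left (pos_of_ne_zero hu0)).ne',
    max_lt hu1 (ENNReal.rpow_lt_one hu1 hε), fun n => ?_⟩
  set N := weightedNorm p (distWeight ε) (A n)
  calc weightedNorm p 1 (A n) ≤ K ^ p * C * s ^ (2 * n) + s ^ (2 * n) * N :=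
        (hC (A n) _ (fun k l => (hA n k l).trans (ha n)) (u ^ (2 * n)) (pow_ne_zero _ hu0)
          (pow_le_one' hu1.le _)).trans (add_le_add (hband n) (mul_le_mul_left (hfar n) N))
    _ ≤ (K ^ p * C * s ^ (2 * n) + s ^ (2 * n) * N) +
          (K ^ p * C * s ^ (2 * n) * N + s ^ (2 * n)) := le_self_add
    _ = (K ^ p * C + 1) * s ^ (2 * n) * (1 + N) := by ring

section Operators

variable [NontriviallyNormedField 𝕜] [NormedSpace 𝕜 E] {q : ℝ≥0∞} [Fact (1 ≤ q)] {r : ℝ≥0∞}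

lemma HasPolynomialGrowth.tsum_weightedNorm_entry_pow_ne_top (hι : HasPolynomialGrowth ι)
    (hp0 : 0 < p) (hp1 : p ≤ 1) (hε : 0 < ε) (hq : q ≠ ∞) {T : LpEnd 𝕜 ι E q}
    (hT : HasGeometricRate (fun n => ‖T ^ n‖ₑ) r) (hr : r < 1)
    (hfin : weightedNorm p (distWeight ε) (entry T) ≠ ∞) :
    ∑' n, weightedNorm p (distWeight ε) (entry (T ^ n)) ≠ ∞ := by
  obtain ⟨C, hC, s, hs0, hs1, hweak⟩ := hι.exists_weightedNorm_one_le_pow_mul hp0 hε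
    (fun n => enorm_entry_le (T ^ n)) hT hr
  refine tsum_ne_top_of_brandenburg (c := 2 ^ ε) (by finiteness) hC hs0 hs1 ?_ (by simpa) ?_ ?_
    hweak
  · rw [pow_zero]
    exact ne_top_of_le_ne_top ENNReal.one_ne_top
      (weightedNorm_entry_one_le hp0 fun k => (distWeight_self ε k).le)
  · exact fun n => weightedNorm_one_le_distWeight hε.le _
  · intro m n
    rw [pow_add]
    exact weightedNorm_mul_le hp0 hp1 (distWeight_le_mul_add hε.le)
      (enorm_entry_mul_le _ _ hq)

variable [CompleteSpace E]

lemma HasPolynomialGrowth.exists_inverse_one_sub (hι : HasPolynomialGrowth ι)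
    (hp0 : 0 < p) (hp1 : p ≤ 1) (hε : 0 < ε) (hq : q ≠ ∞) {T : LpEnd 𝕜 ι E q}
    (hT : HasGeometricRate (fun n => ‖T ^ n‖ₑ) r) (hr : r < 1)
    (hfin : weightedNorm p (distWeight ε) (entry T) ≠ ∞) :
    ∃ S : LpEnd 𝕜 ι E q, weightedNorm p (distWeight ε) (entry S) ≠ ∞ ∧
      (1 - T) * S = 1 ∧ S * (1 - T) = 1 := by
  have hsum : Summable fun n => T ^ n := Summable.of_enorm (hT.tsum_ne_top hr)
  refine ⟨∑' n, T ^ n, ne_top_of_le_ne_top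
    (hι.tsum_weightedNorm_entry_pow_ne_top hp0 hp1 hε hq hT hr hfin) ?_,
    hsum.one_sub_mul_tsum_pow, hsum.tsum_pow_mul_one_sub⟩
  exact weightedNorm_le_tsum hp0 hp1 fun k l => hsum.hasSum.mapL (entryCLM k l)

end Operators

lemma HasPolynomialGrowth.exists_inverse_of_spectralRadius_lt [NormedSpace ℂ E] [CompleteSpace E]
    {q : ℝ≥0∞} [Fact (1 ≤ q)] (hι : HasPolynomialGrowth ι) (hp0 : 0 < p) (hp1 : p ≤ 1)
    (hε : 0 < ε) (hq : q ≠ ∞) {T : LpEnd ℂ ι E q}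
    (hfin : weightedNorm p (distWeight ε) (entry T) ≠ ∞) {z : ℂ}
    (hz : spectralRadius ℂ T < ‖z‖ₑ) :
    ∃ S : LpEnd ℂ ι E q, weightedNorm p (distWeight ε) (entry S) ≠ ∞ ∧
      (z • 1 - T) * S = 1 ∧ S * (z • 1 - T) = 1 := by
  have hzpos : ‖z‖ₑ ≠ 0 := (zero_le.trans_lt hz).ne'
  have hz0 : z ≠ 0 := enorm_ne_zero.1 hzpos
  have hsmul (c : ℂ) {R : LpEnd ℂ ι E q} (hR : weightedNorm p (distWeight ε) (entry R) ≠ ∞) :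
      weightedNorm p (distWeight ε) (entry (c • R)) ≠ ∞ := by
    rw [entry_smul]
    exact ne_top_of_le_ne_top (by finiteness) (weightedNorm_smul_le hp0.le c _)
  obtain ⟨r, hTr, hrz⟩ := exists_between hz
  have hrate : HasGeometricRate (fun n => ‖(z⁻¹ • T) ^ n‖ₑ) (‖z⁻¹‖ₑ * r) := by
    obtain ⟨K, hK, hT⟩ := hasGeometricRate_enorm_pow hrz.ne_top hTr
    refine ⟨K, hK, fun n => ?_⟩
    calc ‖(z⁻¹ • T) ^ n‖ₑ = ‖z⁻¹‖ₑ ^ n * ‖T ^ n‖ₑ := by rw [smul_pow, enorm_smul, enorm_pow]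
      _ ≤ ‖z⁻¹‖ₑ ^ n * (K * r ^ n) := by gcongr; exact hT n
      _ = K * (‖z⁻¹‖ₑ * r) ^ n := by ring
  have hrate1 : ‖z⁻¹‖ₑ * r < 1 := by
    rw [enorm_inv hz0, ← ENNReal.div_eq_inv_mul]
    exact ENNReal.div_lt_of_lt_mul (by rwa [one_mul])
  obtain ⟨S, hS, hright, hleft⟩ :=
    hι.exists_inverse_one_sub hp0 hp1 hε hq hrate hrate1 (hsmul z⁻¹ hfin)
  have hfac : z • 1 - T = z • (1 - z⁻¹ • T) := by rw [smul_sub, smul_inv_smul₀ hz0]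
  refine ⟨z⁻¹ • S, hsmul _ hS, ?_, ?_⟩
  · rw [hfac, smul_mul_smul_comm, mul_inv_cancel₀ hz0, one_smul, hright]
  · rw [hfac, smul_mul_smul_comm, inv_mul_cancel₀ hz0, one_smul, hleft]

end Brandenburg

section Spectrum

variable {d : ℕ} {X : Set (EuclideanSpace ℝ (Fin d))}
  {H : Type*} [NormedAddCommGroup H] [InnerProductSpace ℂ H] {p δ : ℝ}

lemma schurNorm_eq_weightedNorm (hp : 0 ≤ p) (ν : EuclideanSpace ℝ (Fin d) → ℝ)
    (A : Matrix X X (H →L[ℂ] H)) :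
    schurNorm p ν A = weightedNorm p (fun k l : X => ENNReal.ofReal (ν (k - l) ^ p)) A := by
  have hentry (k l : X) : ENNReal.ofReal (‖A k l‖ ^ p * ν (k - l) ^ p) =
      ‖A k l‖ₑ ^ p * ENNReal.ofReal (ν (k - l) ^ p) := by
    rw [ENNReal.ofReal_mul (by positivity), ← ENNReal.ofReal_rpow_of_nonneg (norm_nonneg _) hp,
      ofReal_norm]
  simp only [schurNorm, weightedNorm, kernelNorm, hentry]

lemma ofReal_polyWeight_rpow (hδp : 0 ≤ δ * p) (k l : X) :
    ENNReal.ofReal (polyWeight δ (k - l : EuclideanSpace ℝ (Fin d)) ^ p) =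
      distWeight (δ * p) k l := by
  rw [polyWeight, ← Real.rpow_mul (by positivity),
    ← ENNReal.ofReal_rpow_of_nonneg (by positivity) hδp,
    ENNReal.ofReal_add zero_le_one (norm_nonneg _), ENNReal.ofReal_one, ← dist_eq_norm,
    ← edist_dist, ← Subtype.edist_eq, distWeight]

lemma mem_schurClass_polyWeight_iff (hp : 0 ≤ p) (hδ : 0 ≤ δ) {A : Matrix X X (H →L[ℂ] H)} :
    A ∈ schurClass X H p (polyWeight δ) ↔ weightedNorm p (distWeight (δ * p)) A ≠ ∞ := by
  rw [schurClass, Set.mem_ofPred_eq, schurNorm_eq_weightedNorm hp, lt_top_iff_ne_top]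
  simp only [ofReal_polyWeight_rpow (mul_nonneg hδ hp)]

lemma mem_schurClass_one_iff (hp : 0 ≤ p) {A : Matrix X X (H →L[ℂ] H)} :
    A ∈ schurClass X H p (fun _ => 1) ↔ weightedNorm p 1 A ≠ ∞ := by
  rw [schurClass, Set.mem_ofPred_eq, schurNorm_eq_weightedNorm hp, lt_top_iff_ne_top]
  simp only [Real.one_rpow, ENNReal.ofReal_one]
  rfl

lemma schurClass_polyWeight_subset (hp : 0 ≤ p) (hδ : 0 ≤ δ) :
    schurClass X H p (polyWeight δ) ⊆ schurClass X H p (fun _ => 1) := fun A hA =>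
  (mem_schurClass_one_iff hp).2 <| ne_top_of_le_ne_top
    ((mem_schurClass_polyWeight_iff hp hδ).1 hA)
    (weightedNorm_one_le_distWeight (mul_nonneg hδ hp) A)

lemma schurSpectrum_anti {ν ν' : EuclideanSpace ℝ (Fin d) → ℝ}
    (h : schurClass X H p ν' ⊆ schurClass X H p ν) (A : Matrix X X (H →L[ℂ] H)) :
    schurSpectrum p ν A ⊆ schurSpectrum p ν' A :=
  fun _ hz ⟨B, hB, hinv⟩ => hz ⟨B, h hB, hinv⟩

lemma schurRadius_eq_rpow_iSup_enorm (hp : 0 < p) (ν : EuclideanSpace ℝ (Fin d) → ℝ)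
    (A : Matrix X X (H →L[ℂ] H)) :
    schurRadius p ν A = (⨆ z ∈ schurSpectrum p ν A, ‖z‖ₑ) ^ p := by
  have hnorm (z : ℂ) : ENNReal.ofReal (‖z‖ ^ p) = ENNReal.orderIsoRpow p hp ‖z‖ₑ := by
    rw [ENNReal.orderIsoRpow_apply, ← ENNReal.ofReal_rpow_of_nonneg (norm_nonneg z) hp.le,
      ofReal_norm]
  simp only [schurRadius, hnorm, ← OrderIso.map_iSup]
  rfl

lemma entry_smul_one_sub_mem_schurClass_one (hp0 : 0 < p) (hp1 : p ≤ 1) (z : ℂ)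
    {T : LpEnd ℂ X H 2} (hT : entry T ∈ schurClass X H p (fun _ => 1)) :
    entry (z • 1 - T) ∈ schurClass X H p (fun _ => 1) := by
  rw [mem_schurClass_one_iff hp0.le] at hT ⊢
  refine ne_top_of_le_ne_top (b := ‖z‖ₑ ^ p * 1 + weightedNorm p 1 (entry T)) (by finiteness) ?_
  rw [entry_sub, entry_smul]
  refine (weightedNorm_sub_le hp0.le hp1 _ _).trans ?_
  gcongr
  refine (weightedNorm_smul_le hp0.le z _).trans ?_
  gcongr
  exact weightedNorm_entry_one_le hp0 fun _ => le_rfl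

lemma kernelNorm_enorm_ne_top_of_mem_schurClass_one (hp0 : 0 < p) (hp1 : p ≤ 1)
    {A : Matrix X X (H →L[ℂ] H)} (hA : A ∈ schurClass X H p (fun _ => 1)) :
    kernelNorm (fun k l => ‖A k l‖ₑ) ≠ ∞ := by
  refine ne_top_of_le_ne_top (ENNReal.rpow_ne_top_of_nonneg (inv_nonneg.2 hp0.le) ?_)
    (kernelNorm_le_kernelNorm_rpow_rpow_inv (fun k l => ‖A k l‖ₑ) hp0 hp1)
  simpa [weightedNorm] using (mem_schurClass_one_iff hp0.le).1 hA

variable [CompleteSpace H]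

lemma exists_entry_eq_of_mem_schurClass_one (hp0 : 0 < p) (hp1 : p ≤ 1)
    {A : Matrix X X (H →L[ℂ] H)} (hA : A ∈ schurClass X H p (fun _ => 1)) :
    ∃ T : LpEnd ℂ X H 2, entry T = A :=
  exists_entry_eq ENNReal.ofNat_ne_top (kernelNorm_enorm_ne_top_of_mem_schurClass_one hp0 hp1 hA)

lemma matMul_entry (hp0 : 0 < p) (hp1 : p ≤ 1) {S : LpEnd ℂ X H 2}
    (hS : entry S ∈ schurClass X H p (fun _ => 1)) (T : LpEnd ℂ X H 2) :
    matMul (entry S) (entry T) = entry (S * T) := by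
  ext1 k l
  have hrow : ∑' m, ‖entry S k m‖ₑ ≠ ∞ :=
    ne_top_of_le_ne_top (kernelNorm_enorm_ne_top_of_mem_schurClass_one hp0 hp1 hS)
      (row_le_kernelNorm (fun k l => ‖entry S k l‖ₑ) k)
  exact (hasSum_entry_mul S T ENNReal.ofNat_ne_top hrow l).tsum_eq

lemma matMul_entry_eq_one_iff [DecidableEq X] (hp0 : 0 < p) (hp1 : p ≤ 1) {S : LpEnd ℂ X H 2}
    (hS : entry S ∈ schurClass X H p (fun _ => 1)) (T : LpEnd ℂ X H 2) :
    matMul (entry S) (entry T) = 1 ↔ S * T = 1 := by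
  rw [matMul_entry hp0 hp1 hS, ← entry_one (q := 2)]
  exact (entry_injective (q := 2) ENNReal.ofNat_ne_top).eq_iff

/-- Every matrix in the unweighted class, in particular every candidate for an inverse, represents
an operator, so invertibility can be tested on operators. -/
lemma notMem_schurSpectrum_iff (hp0 : 0 < p) (hp1 : p ≤ 1) {ν : EuclideanSpace ℝ (Fin d) → ℝ}
    (hν : schurClass X H p ν ⊆ schurClass X H p (fun _ => 1)) {T : LpEnd ℂ X H 2}
    (hT : entry T ∈ schurClass X H p (fun _ => 1)) {z : ℂ} :
    z ∉ schurSpectrum p ν (entry T) ↔ ∃ S : LpEnd ℂ X H 2, entry S ∈ schurClass X H p ν ∧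
      (z • 1 - T) * S = 1 ∧ S * (z • 1 - T) = 1 := by
  classical
  have hzT := entry_smul_one_sub_mem_schurClass_one hp0 hp1 z hT
  have hmatrix : z • 1 - entry T = entry (z • 1 - T) := by rw [entry_sub, entry_smul, entry_one]
  have hinv {S : LpEnd ℂ X H 2} (hS : entry S ∈ schurClass X H p ν) :
      matMul (entry (z • 1 - T)) (entry S) = 1 ∧ matMul (entry S) (entry (z • 1 - T)) = 1 ↔
        (z • 1 - T) * S = 1 ∧ S * (z • 1 - T) = 1 :=
    and_congr (matMul_entry_eq_one_iff hp0 hp1 hzT S)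
      (matMul_entry_eq_one_iff hp0 hp1 (hν hS) _)
  rw [schurSpectrum, Set.mem_ofPred_eq, not_not, hmatrix]
  constructor
  · rintro ⟨B, hB, hBinv⟩
    obtain ⟨S, rfl⟩ := exists_entry_eq_of_mem_schurClass_one hp0 hp1 (hν hB)
    exact ⟨S, hB, (hinv hB).1 hBinv⟩
  · rintro ⟨S, hS, hSinv⟩
    exact ⟨entry S, hS, (hinv hS).2 hSinv⟩

lemma spectrum_subset_schurSpectrum (hp0 : 0 < p) (hp1 : p ≤ 1) {T : LpEnd ℂ X H 2}
    (hT : entry T ∈ schurClass X H p (fun _ => 1)) :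
    spectrum ℂ T ⊆ schurSpectrum p (fun _ => 1) (entry T) := by
  intro z hz
  by_contra hzT
  obtain ⟨S, -, hright, hleft⟩ := (notMem_schurSpectrum_iff hp0 hp1 subset_rfl hT).1 hzT
  refine hz ?_
  rw [spectrum.mem_resolventSet_iff, Algebra.algebraMap_eq_smul_one]
  exact ⟨⟨_, S, hright, hleft⟩, rfl⟩

lemma IsRelativelySeparated.enorm_le_spectralRadius_of_mem_schurSpectrum
    (hX : IsRelativelySeparated X) (hp0 : 0 < p) (hp1 : p ≤ 1) (hδ : 0 < δ) {T : LpEnd ℂ X H 2}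
    (hT : entry T ∈ schurClass X H p (polyWeight δ)) {z : ℂ}
    (hz : z ∈ schurSpectrum p (polyWeight δ) (entry T)) : ‖z‖ₑ ≤ spectralRadius ℂ T := by
  contrapose! hz
  have hsub := schurClass_polyWeight_subset (X := X) (H := H) hp0.le hδ.le
  rw [notMem_schurSpectrum_iff hp0 hp1 hsub (hsub hT)]
  simp only [mem_schurClass_polyWeight_iff hp0.le hδ.le] at hT ⊢
  exact hX.hasPolynomialGrowth.exists_inverse_of_spectralRadius_lt hp0 hp1 (mul_pos hδ hp0)
    ENNReal.ofNat_ne_top hT hz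

end Spectrum

end SchurAlg

open SchurAlg in
theorem theorem3p5_general {d : ℕ} (X : Set (EuclideanSpace ℝ (Fin d)))
    (hX : IsRelativelySeparated X)
    {H : Type*} [NormedAddCommGroup H] [InnerProductSpace ℂ H] [CompleteSpace H]
    (p : ℝ) (hp0 : 0 < p) (hp1 : p ≤ 1) (δ : ℝ) (hδ : 0 < δ)
    (A : Matrix X X (H →L[ℂ] H)) (hA : A ∈ schurClass X H p (polyWeight δ)) :
    ∃ T : lp (fun _ : X => H) 2 →L[ℂ] lp (fun _ : X => H) 2,
      IsOperatorOf T A ∧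
      schurRadius p (polyWeight δ) A = schurRadius p (fun _ => 1) A ∧
      schurRadius p (fun _ => 1) A = (spectralRadius ℂ T) ^ p := by
  have hsub := schurClass_polyWeight_subset (X := X) (H := H) hp0.le hδ.le
  obtain ⟨T, rfl⟩ := exists_entry_eq_of_mem_schurClass_one hp0 hp1 (hsub hA)
  have hle_one : spectralRadius ℂ T ≤ ⨆ z ∈ schurSpectrum p (fun _ => 1) (entry T), ‖z‖ₑ :=
    biSup_mono fun _ hz => spectrum_subset_schurSpectrum hp0 hp1 (hsub hA) hz
  have hle_poly : ⨆ z ∈ schurSpectrum p (fun _ => 1) (entry T), ‖z‖ₑ ≤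
      ⨆ z ∈ schurSpectrum p (polyWeight δ) (entry T), ‖z‖ₑ :=
    biSup_mono fun _ hz => schurSpectrum_anti hsub _ hz
  have hle_op : ⨆ z ∈ schurSpectrum p (polyWeight δ) (entry T), ‖z‖ₑ ≤ spectralRadius ℂ T :=
    iSup₂_le fun _ hz => hX.enorm_le_spectralRadius_of_mem_schurSpectrum hp0 hp1 hδ hA hz
  simp only [schurRadius_eq_rpow_iSup_enorm hp0]
  exact ⟨T, hasSum_entry T ENNReal.ofNat_ne_top,
    congrArg (· ^ p) (le_antisymm (hle_op.trans hle_one) hle_poly),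
    congrArg (· ^ p) (le_antisymm (hle_poly.trans hle_op) hle_one)⟩

theorem theorem3p5 {d : ℕ} (X : Set (EuclideanSpace ℝ (Fin d)))
    (hX : SchurAlg.IsRelativelySeparated X)
    {H : Type*} [NormedAddCommGroup H] [InnerProductSpace ℂ H] [CompleteSpace H]
    (p : ℝ) (hp0 : 0 < p) (hp1 : p ≤ 1) (δ : ℝ) (hδ0 : 0 < δ) (hδ1 : δ ≤ 1)
    (A : Matrix X X (H →L[ℂ] H))
    (hA : A ∈ SchurAlg.schurClass X H p (SchurAlg.polyWeight δ))
    (hsa : A.IsHermitian) :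
    ∃ T : lp (fun _ : X => H) 2 →L[ℂ] lp (fun _ : X => H) 2,
      SchurAlg.IsOperatorOf T A ∧
      SchurAlg.schurRadius p (SchurAlg.polyWeight δ) A
        = SchurAlg.schurRadius p (fun _ => 1) A ∧
      SchurAlg.schurRadius p (fun _ => 1) A = (spectralRadius ℂ T) ^ p :=
  theorem3p5_general X hX p hp0 hp1 δ hδ0 A hA
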